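/- Consider a shared-link caching network with $n$ users, a library of $m$ files of equal size, caches of size $M>0$ files, and $L$ requests per user; all $nL$ requests are i.i.d. with distribution $\mathbf q=(q_1,\dots,q_m)$. Fix a caching distribution $\mathbf p=(p_1,\dots,p_m)$, $\sum_f p_f=1$, $0\le p_f\le 1/M$. *Caching (RAP).* Each file is split into $B$ packets. Independently for every user $u$ and file $f$, user $u$ caches a uniformly random set $\mathbf C_{u,f}$ of $p_fMB$ (rounded down to an integer) distinct packets of $f$. *Delivery (GCLC).* Given the placement $\mathbf C$ and the requests, form the directed conflict graph: its vertices $v$ are the pairs (packet $\rho(v)$, user $\mu(v)$) such that $\rho(v)$ belongs to a file requested by $\mu(v)$ and is not cached by $\mu(v)$; there is an edge from $v_2$ to $v_1$ if $\rho(v_1)\neq\rho(v_2)$ and $\rho(v_1)$ is not cached by $\mu(v_2)$. For a vertex colouring $c$, the local number of colours is the maximum over $v$ of the number of colours occurring on $v$ and its out-neighbours (and $0$ if there are no vertices). The label of $v$ is the set consisting of $\mu(v)$ and all users caching $\rho(v)$. GCLC computes two colourings: (i) repeatedly pick an arbitrary uncoloured vertex $v$, set $I=\{v\}$, scan the other uncoloured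 vertices in an arbitrary order, adding a vertex to $I$ if it has the same label as $v$ and is not joined by an edge (in either direction) to a vertex of $I$, and give $I$ a new colour; (ii) give two vertices the same colour exactly if their packets are the same. The number $\nu$ of packet transmissions is the smaller of the two local numbers of colours. The rate is $R^{\rm RAP\text{-}GCLC}=\mathbb E[\nu\mid\mathbf C]/B$, the expectation being over the requests; it is a random variable, as a function of $\mathbf C$. Then, for all $\varepsilon>0$, whatever arbitrary choices are made in (i), $$\lim_{B\to\infty}\mathbb P\left(R^{\rm RAP\text{-}GCLC}\le\min\{\psi(\mathbf q,\mathbf p),\bar m-\bar M\}+\varepsilon\right)=1,$$ where the probability is over the random placement $\mathbf C$, $$\bar m=\sum_{f=1}^m\left(1-(1-q_f)^{nL}\right),\qquad \bar M=\sum_{f=1}^m p_fM\left(1-(1-q_f)^{nL}\right),$$ $$\psi(\mathbf q,\mathbf p)=L\sum_{\ell=1}^n\binom n\ell\sum_{f=1}^m\rho_{f,\ell}\,(1-p_fM)^{n-\ell+1}(p_fM)^{\ell-1},$$ and $\rho_{f,\ell}$ is the probability that $f$ is the file $j$ maximizing $(p_jM)^{\ell-1}(1-p_jM)^{n-\ell+1}$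 among $\ell$ i.i.d. demands distributed as $\mathbf q$, ties being broken in favour of the smallest index. -/

import Mathlib

open Filter Topology

namespace RapGclc

/-! ### Packets, cache placements, demands

Users are `Fin n`, files are `Fin m`; every file consists of `B` packets. -/

/-- A packet: a file together with the position of the packet in that file. -/
abbrev Packet (m B : ℕ) : Type := Fin m × Fin B

/-- A packet-level cache configuration: `C u f` is the set of (positions of) packets of file `f`
that user `u` caches. -/
abbrev Placement (n m B : ℕ) : Type := Fin n → Fin m → Finset (Fin B)

/-- A request configuration: `F u l` is the `l`-th request of user `u`. -/
abbrev Demand (n m L : ℕ) : Type := Fin n → Fin L → Fin m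

/-- A candidate vertex of the conflict graph: a packet and a user requesting it. -/
abbrev Vertex (n m B : ℕ) : Type := Packet m B × Fin n

/-- User `u` has packet `ρ` in its cache. -/
abbrev Caches {n m B : ℕ} (C : Placement n m B) (u : Fin n) (ρ : Packet m B) : Prop :=
  ρ.2 ∈ C u ρ.1

/-! ### The directed conflict graph -/

/-- The vertex set: one vertex for every user `u` and every packet that `u` needs, that is, every
packet of a file requested by `u` which is not already in the cache of `u`. -/
def vertices {n m B L : ℕ} (C : Placement n m B) (F : Demand n m L) : Finset (Vertex n m B) :=
  Finset.univ.filter fun v => (∃ l, F v.2 l = v.1.1) ∧ ¬ Caches C v.2 v.1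

/-- `v₁` interferes with `v₂`: the packet of `v₁` is not in the cache of the user of `v₂`, and the
two packets are different. There is then a directed edge from `v₂` to `v₁`. -/
abbrev Interferes {n m B : ℕ} (C : Placement n m B) (v₁ v₂ : Vertex n m B) : Prop :=
  ¬ Caches C v₂.2 v₁.1 ∧ v₁.1 ≠ v₂.1

/-- Adjacency in the underlying undirected graph. -/
abbrev Conflict {n m B : ℕ} (C : Placement n m B) (v w : Vertex n m B) : Prop :=
  Interferes C v w ∨ Interferes C w v

/-- The closed out-neighbourhood of `v` in the directed conflict graph. -/
def closedOutNeighbors {n m B L : ℕ} (C : Placement n m B) (F : Demand n m L)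
    (v : Vertex n m B) : Finset (Vertex n m B) :=
  (vertices C F).filter fun w => w = v ∨ Interferes C w v

/-- The largest number of colours that a colouring `c` shows in a closed out-neighbourhood
(`0` if there are no vertices). This is the number of packet transmissions used by the local
colouring index code built on `c`. -/
def localColors {n m B L : ℕ} {κ : Type} [DecidableEq κ] (C : Placement n m B) (F : Demand n m L)
    (c : Vertex n m B → κ) : ℕ :=
  (vertices C F).sup fun v => ((closedOutNeighbors C F v).image c).card

/-! ### Greedy constrained local colouring -/

/-- The label of a vertex: the user requesting the packet and all users caching the packet. -/
def label {n m B : ℕ} (C : Placement n m B) (v : Vertex n m B) : Finset (Fin n) :=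
  insert v.2 (Finset.univ.filter fun u => Caches C u v.1)

/-- The colour class grown from the vertex `v` by scanning the list `l`: a scanned vertex is added
if it has the same label as `v` and conflicts with no vertex that is already in the class. -/
def greedyClass {n m B : ℕ} (C : Placement n m B) (v : Vertex n m B) (l : List (Vertex n m B)) :
    Finset (Vertex n m B) :=
  l.foldl (fun I w => if label C w = label C v ∧ ∀ x ∈ I, ¬ Conflict C x w then insert w I else I)
    {v}

/-- `GreedyRun C k S c`: the colouring `c` can result on the still uncoloured set `S` from the
constrained greedy procedure when `k` is the first unused colour. In each round an arbitrary
uncoloured vertex is picked, the other uncoloured vertices are scanned in an arbitrary order,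
and the class so obtained receives a new colour. -/
inductive GreedyRun {n m B : ℕ} (C : Placement n m B) :
    ℕ → Finset (Vertex n m B) → (Vertex n m B → ℕ) → Prop
  | done (k : ℕ) (c : Vertex n m B → ℕ) : GreedyRun C k ∅ c
  | round (k : ℕ) (S : Finset (Vertex n m B)) (c : Vertex n m B → ℕ)
      (v : Vertex n m B) (hv : v ∈ S)
      (l : List (Vertex n m B)) (hnodup : l.Nodup) (hl : l.toFinset = S.erase v)
      (hc : ∀ w ∈ greedyClass C v l, c w = k)
      (hrest : GreedyRun C (k + 1) (S \ greedyClass C v l) c) :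
      GreedyRun C k S c

/-- `c` is a possible output of the constrained greedy colouring of the whole conflict graph. -/
def IsGreedyColoring {n m B L : ℕ} (C : Placement n m B) (F : Demand n m L)
    (c : Vertex n m B → ℕ) : Prop :=
  GreedyRun C 0 (vertices C F) c

/-- The number of packet transmissions of GCLC: the better, in local number of colours, of the
constrained greedy colouring `c` and the colouring in which two vertices have the same colour
exactly if they stand for the same packet. -/
def transmissions {n m B L : ℕ} (C : Placement n m B) (F : Demand n m L)
    (c : Vertex n m B → ℕ) : ℕ :=
  min (localColors C F c) (localColors C F fun v => v.1)

/-! ### Probabilities -/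

/-- The probability of the demand configuration `F`: all requests are independent with
distribution `q`. -/
def demandProb {n m L : ℕ} (q : Fin m → ℝ) (F : Demand n m L) : ℝ :=
  ∏ u, ∏ l, q (F u l)

/-- The number of packets of file `f` that each user caches, `p_f M B` (rounded down). -/
noncomputable def cachedCount {m : ℕ} (M : ℝ) (p : Fin m → ℝ) (B : ℕ) (f : Fin m) : ℕ :=
  ⌊p f * M * B⌋₊

/-- The probability of the placement `C` under RAP caching: independently for all users and
files, a uniformly random set of `cachedCount M p B f` packets of `f` is cached. -/
noncomputable def placementProb {n m B : ℕ} (M : ℝ) (p : Fin m → ℝ) (C : Placement n m B) : ℝ :=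
  ∏ u, ∏ f, if (C u f).card = cachedCount M p B f
    then ((B.choose (cachedCount M p B f) : ℕ) : ℝ)⁻¹ else 0

open Classical in
/-- The probability of an event under RAP caching. -/
noncomputable def rapProb {n m B : ℕ} (M : ℝ) (p : Fin m → ℝ) (E : Placement n m B → Prop) : ℝ :=
  ∑ C : Placement n m B, if E C then placementProb M p C else 0

/-- The rate, in file units, for the placement `C`: the number of packet transmissions, averaged
over the random demands, divided by the number of packets per file. `c F` is the greedy
colouring that was obtained for the demands `F`. -/
noncomputable def rate {n m B L : ℕ} (q : Fin m → ℝ) (C : Placement n m B)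
    (c : Demand n m L → Vertex n m B → ℕ) : ℝ :=
  (∑ F : Demand n m L, demandProb q F * (transmissions C F (c F) : ℝ)) / B

/-! ### The bound -/

/-- The quantity `(p_j M)^(ℓ-1) (1 - p_j M)^(n-ℓ+1)` (for `1 ≤ ℓ ≤ n`). -/
def weight {m : ℕ} (n : ℕ) (M : ℝ) (p : Fin m → ℝ) (ℓ : ℕ) (j : Fin m) : ℝ :=
  (1 - p j * M) ^ (n - ℓ + 1) * (p j * M) ^ (ℓ - 1)

/-- `f` is the file maximizing `weight` among the demands `d` (ties go to the smallest index). -/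
def IsArgmax {m : ℕ} (n : ℕ) (M : ℝ) (p : Fin m → ℝ) (ℓ : ℕ) (d : Fin ℓ → Fin m) (f : Fin m) :
    Prop :=
  (∃ i, d i = f) ∧ ∀ i, weight n M p ℓ (d i) ≤ weight n M p ℓ f ∧
    (weight n M p ℓ (d i) = weight n M p ℓ f → f ≤ d i)

open Classical in
/-- `ρ_{f,ℓ}`: the probability that `f` is the maximizing file among `ℓ` independent demands with
distribution `q`. -/
noncomputable def rho {m : ℕ} (n : ℕ) (M : ℝ) (q p : Fin m → ℝ) (f : Fin m) (ℓ : ℕ) : ℝ :=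
  ∑ d : Fin ℓ → Fin m, if IsArgmax n M p ℓ d f then ∏ i, q (d i) else 0

noncomputable def psi {m : ℕ} (n L : ℕ) (M : ℝ) (q p : Fin m → ℝ) : ℝ :=
  L * ∑ ℓ ∈ Finset.Icc 1 n, (n.choose ℓ : ℝ) *
    ∑ f, rho n M q p f ℓ * ((1 - p f * M) ^ (n - ℓ + 1) * (p f * M) ^ (ℓ - 1))

/-- The expected number of distinct requested files. -/
def mBar {m : ℕ} (n L : ℕ) (q : Fin m → ℝ) : ℝ :=
  ∑ f, (1 - (1 - q f) ^ (n * L))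

/-- The expected number of file units of requested files that a user has in its cache. -/
def MBar {m : ℕ} (n L : ℕ) (M : ℝ) (q p : Fin m → ℝ) : ℝ :=
  ∑ f, p f * M * (1 - (1 - q f) ^ (n * L))

end RapGclc

namespace RapGclc

open Finset

variable {n m B L : ℕ}

/-! ### The number of colours of the constrained greedy colouring -/

/-! Both bounds are proved separately; as `transmissions` is a minimum, its mean over demands is at
most either mean. Greedy colouring: vertices with equal labels and different users never conflict,
so a greedy class with label `A` takes a vertex from every user that still has one with that label.
Hence the number of colours is at most `labelBound`, the sum over `A` of the largest number of
`A`-vertices of one user (`card_image_le_labelBound`). For `u ∈ A` these vertices are packets of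
files requested by `u` that are cached exactly by `A.erase u`. Packet memberships in a uniform
`k`-subset are nonpositively correlated, so such counts have variance at most `B`
(`rapMean_sq_sub_le`) and Chebyshev's inequality applies. Outside finitely many bad events, `m * 2 ^
n` in number, every count is near its mean, and averaging the largest weight over demands gives
`psi` (`sum_demandProb_mul_totalMaxWeight`). Packet colouring: the packets seen from `v` belong to
requested files and are missing from one cache, so counting them gives `mBar - MBar` up to rounding
(`rate_le_mBar_sub`). The good event depends on the placement alone, so the bound holds for all
greedy colourings at once. -/

/-- Each of the two users lies in the other vertex's label without being its requester, hence caches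
the other's packet; this excludes both edges. -/
theorem not_conflict_of_label_eq {C : Placement n m B} {v w : Vertex n m B}
    (h : label C v = label C w) (huser : v.2 ≠ w.2) : ¬ Conflict C v w := by
  have h1 : w.2 ∈ label C v := by rw [h]; simp [label]
  have h2 : v.2 ∈ label C w := by rw [← h]; simp [label]
  simp only [label, mem_insert, mem_filter, mem_univ, true_and] at h1 h2
  have h1 := h1.resolve_left huser.symm
  have h2 := h2.resolve_left huser
  rintro (h | h)
  · exact h.1 h1
  · exact h.1 h2

/-- The scan of `greedyClass`, started from an arbitrary set. -/
def greedyScan (C : Placement n m B) (v : Vertex n m B) (l : List (Vertex n m B))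
    (I : Finset (Vertex n m B)) : Finset (Vertex n m B) :=
  l.foldl (fun I w => if label C w = label C v ∧ ∀ x ∈ I, ¬ Conflict C x w then insert w I else I) I

theorem subset_greedyScan (C : Placement n m B) (v : Vertex n m B) (l : List (Vertex n m B)) :
    ∀ I, I ⊆ greedyScan C v l I := by
  induction l with
  | nil => intro I; exact Subset.rfl
  | cons w l ih =>
    intro I
    refine Subset.trans ?_ (ih _)
    dsimp only
    split_ifs
    · exact subset_insert _ _
    · exact Subset.rfl

theorem label_eq_of_mem_greedyScan (C : Placement n m B) (v : Vertex n m B)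
    (l : List (Vertex n m B)) : ∀ I, (∀ x ∈ I, label C x = label C v) →
      ∀ x ∈ greedyScan C v l I, label C x = label C v := by
  induction l with
  | nil => intro I hI; exact hI
  | cons w l ih =>
    intro I hI
    refine ih _ ?_
    dsimp only
    split_ifs with h
    · intro x hx
      rcases mem_insert.1 hx with rfl | hx
      · exact h.1
      · exact hI x hx
    · exact hI

/-- The class only grows during the scan, so the obstacle that caused a rejection is still in the
final class. -/
theorem greedyScan_maximal (C : Placement n m B) (v : Vertex n m B) (l : List (Vertex n m B)) :
    ∀ I, ∀ w ∈ l, label C w = label C v →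
      w ∈ greedyScan C v l I ∨ ∃ x ∈ greedyScan C v l I, Conflict C x w := by
  induction l with
  | nil => intro I w hw; simp at hw
  | cons a l ih =>
    intro I w hw hlab
    rcases List.mem_cons.1 hw with rfl | hw
    · by_cases h : ∀ x ∈ I, ¬ Conflict C x w
      · left
        refine subset_greedyScan C v l _ ?_
        dsimp only
        rw [if_pos ⟨hlab, h⟩]
        exact mem_insert_self _ _
      · right
        push Not at h
        obtain ⟨x, hx, hc⟩ := h
        exact ⟨x, subset_greedyScan C v (w :: l) I hx, hc⟩
    · exact ih _ w hw hlab

/-- If `w` was rejected, it conflicts with a class member of the same label, and such a conflict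
forces the users to agree. -/
theorem exists_mem_greedyClass_user_eq {C : Placement n m B} {S : Finset (Vertex n m B)}
    {v w : Vertex n m B} {l : List (Vertex n m B)} (hl : l.toFinset = S.erase v) (hw : w ∈ S)
    (hlab : label C w = label C v) :
    ∃ x ∈ greedyClass C v l, label C x = label C v ∧ x.2 = w.2 := by
  have hv : v ∈ greedyClass C v l := subset_greedyScan C v l {v} (mem_singleton_self v)
  have hall : ∀ x ∈ greedyClass C v l, label C x = label C v :=
    label_eq_of_mem_greedyScan C v l {v} (by simp)
  by_cases hwv : w = v
  · exact ⟨v, hv, rfl, by rw [hwv]⟩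
  have hwl : w ∈ l := by
    rw [← List.mem_toFinset, hl]
    exact mem_erase.2 ⟨hwv, hw⟩
  rcases greedyScan_maximal C v l {v} w hwl hlab with h | ⟨x, hx, hc⟩
  · exact ⟨w, h, hlab, rfl⟩
  · refine ⟨x, hx, hall x hx, ?_⟩
    by_contra hne
    exact not_conflict_of_label_eq ((hall x hx).trans hlab.symm) hne hc

theorem greedyClass_subset {C : Placement n m B} (v : Vertex n m B) (l : List (Vertex n m B)) :
    greedyClass C v l ⊆ insert v l.toFinset := by
  have key : ∀ (l : List (Vertex n m B)) I, greedyScan C v l I ⊆ I ∪ l.toFinset := by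
    intro l
    induction l with
    | nil => intro I; simp [greedyScan]
    | cons w l ih =>
      intro I
      refine (ih _).trans ?_
      intro x hx
      dsimp only at hx
      split_ifs at hx <;> simp at hx ⊢ <;> tauto
  refine (key l {v}).trans ?_
  intro x hx
  simpa using hx

/-- The vertices of `S` with label `A` and user `u`. -/
def labelUser (C : Placement n m B) (S : Finset (Vertex n m B)) (A : Finset (Fin n)) (u : Fin n) :
    Finset (Vertex n m B) :=
  S.filter fun v => label C v = A ∧ v.2 = u

theorem labelUser_mono (C : Placement n m B) {S T : Finset (Vertex n m B)} (h : S ⊆ T)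
    (A : Finset (Fin n)) (u : Fin n) : labelUser C S A u ⊆ labelUser C T A u :=
  filter_subset_filter _ h

/-- The sum over all labels of the largest number of vertices that one user has with that label. -/
def labelBound (C : Placement n m B) (S : Finset (Vertex n m B)) : ℕ :=
  ∑ A : Finset (Fin n), univ.sup fun u => (labelUser C S A u).card

/-- `labelBound` is a potential for the greedy run: no summand increases, and the one for the label
of `v` drops because every user with vertices of that label loses at least one. -/
theorem labelBound_round {C : Placement n m B} {S : Finset (Vertex n m B)} {v : Vertex n m B}
    (hv : v ∈ S) {l : List (Vertex n m B)} (hl : l.toFinset = S.erase v) :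
    labelBound C (S \ greedyClass C v l) + 1 ≤ labelBound C S := by
  have hI : greedyClass C v l ⊆ S := by
    refine (greedyClass_subset v l).trans ?_
    rw [hl, insert_erase hv]
  refine Nat.succ_le_of_lt (sum_lt_sum (fun A _ => ?_) ⟨label C v, mem_univ _, ?_⟩)
  · exact sup_mono_fun fun u _ => card_le_card (labelUser_mono C sdiff_subset A u)
  · have hpos : 0 < univ.sup fun u => (labelUser C S (label C v) u).card := by
      refine lt_of_lt_of_le ?_ (le_sup (f := fun u => (labelUser C S (label C v) u).card)
        (mem_univ v.2))
      exact card_pos.2 ⟨v, by simp [labelUser, hv]⟩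
    refine (Finset.sup_lt_iff (by simpa using hpos)).2 fun u _ => ?_
    rcases (labelUser C S (label C v) u).eq_empty_or_nonempty with he | ⟨w, hw⟩
    · have : labelUser C (S \ greedyClass C v l) (label C v) u = ∅ :=
        subset_empty.1 (he ▸ labelUser_mono C sdiff_subset _ u)
      rw [this]
      simpa using hpos
    · refine lt_of_lt_of_le ?_ (le_sup (f := fun u => (labelUser C S (label C v) u).card)
        (mem_univ u))
      simp only [labelUser, mem_filter] at hw
      obtain ⟨x, hx, hxl, hxu⟩ := exists_mem_greedyClass_user_eq hl hw.1 hw.2.1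
      refine card_lt_card ((ssubset_iff_of_subset (labelUser_mono C sdiff_subset _ u)).2
        ⟨x, ?_, ?_⟩)
      · simp only [labelUser, mem_filter]
        exact ⟨hI hx, hxl, hxu.trans hw.2.2⟩
      · simp only [labelUser, mem_filter]
        exact fun h => (mem_sdiff.1 h.1).2 hx

theorem card_image_le_labelBound {C : Placement n m B} {k : ℕ} {S : Finset (Vertex n m B)}
    {c : Vertex n m B → ℕ} (h : GreedyRun C k S c) : (S.image c).card ≤ labelBound C S := by
  induction h with
  | done k c => simp
  | round k S c v hv l hnodup hl hc hrest ih =>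
    refine le_trans ?_ ((Nat.add_le_add_right ih 1).trans (labelBound_round hv hl))
    refine (card_le_card (t := insert k ((S \ greedyClass C v l).image c)) ?_).trans
      (card_insert_le _ _)
    intro a ha
    obtain ⟨w, hw, rfl⟩ := mem_image.1 ha
    by_cases hwI : w ∈ greedyClass C v l
    · rw [hc w hwI]; exact mem_insert_self _ _
    · exact mem_insert_of_mem (mem_image_of_mem c (mem_sdiff.2 ⟨hw, hwI⟩))

/-- The number of packets of file `f` that are cached by exactly the users in `T`. -/
def exactCount (C : Placement n m B) (f : Fin m) (T : Finset (Fin n)) : ℕ :=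
  (univ.filter fun b : Fin B => ∀ u, b ∈ C u f ↔ u ∈ T).card

/-- The requester does not cache its packet, so the users caching it are the label with the
requester removed. -/
theorem card_labelUser_vertices_le (C : Placement n m B) (F : Demand n m L) (A : Finset (Fin n))
    {u : Fin n} (hu : u ∈ A) :
    (labelUser C (vertices C F) A u).card ≤ ∑ l, exactCount C (F u l) (A.erase u) := by
  have hsub : labelUser C (vertices C F) A u ⊆ univ.biUnion fun l =>
      (univ.filter fun b : Fin B => ∀ w, b ∈ C w (F u l) ↔ w ∈ A.erase u).image
        fun b => ((F u l, b), u) := by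
    intro v hv
    simp only [labelUser, vertices, mem_filter, mem_univ, true_and] at hv
    obtain ⟨⟨⟨l, hl⟩, hnc⟩, hlab, rfl⟩ := hv
    simp only [mem_biUnion, mem_univ, true_and, mem_image, mem_filter]
    refine ⟨l, v.1.2, fun w => ?_, by rw [hl]⟩
    rw [hl, ← hlab]
    simp only [label, mem_erase, mem_insert, mem_filter, mem_univ, true_and]
    constructor
    · intro hw
      refine ⟨?_, Or.inr hw⟩
      rintro rfl
      exact hnc hw
    · rintro ⟨hne, h | h⟩
      · exact absurd h hne
      · exact h
  refine (card_le_card hsub).trans (card_biUnion_le.trans (sum_le_sum fun l _ => card_image_le))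

theorem card_labelUser_of_notMem (C : Placement n m B) (S : Finset (Vertex n m B))
    (A : Finset (Fin n)) {u : Fin n} (hu : u ∉ A) : (labelUser C S A u).card = 0 := by
  rw [card_eq_zero, labelUser, filter_eq_empty_iff]
  rintro v _ ⟨rfl, rfl⟩
  exact hu (by simp [label])

/-- For the greedy colouring, locality is given up: all colours are counted. -/
theorem localColors_le_labelBound {C : Placement n m B} {F : Demand n m L}
    {c : Vertex n m B → ℕ} (h : IsGreedyColoring C F c) :
    localColors C F c ≤ labelBound C (vertices C F) := by
  refine Finset.sup_le fun v _ => le_trans (card_le_card ?_) (card_image_le_labelBound h)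
  exact image_subset_image (filter_subset _ _)

/-! ### The number of colours of the packet colouring -/

/-- Every packet in the closed out-neighbourhood of `v` is missing from the cache of the single user
`v.2`, and exactly `B - k f` packets of `f` are missing there. -/
theorem localColors_packet_le (C : Placement n m B) (F : Demand n m L) {k : Fin m → ℕ}
    (hC : ∀ u f, (C u f).card = k f) :
    localColors C F (fun v => v.1) ≤ ∑ f with ∃ u l, F u l = f, (B - k f) := by
  refine Finset.sup_le fun v hv => ?_
  have hsub : (closedOutNeighbors C F v).image (fun w => w.1) ⊆
      (univ.filter fun f => ∃ u l, F u l = f).biUnion fun f =>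
        ((C v.2 f)ᶜ).image fun b => (f, b) := by
    intro ρ hρ
    obtain ⟨w, hw, rfl⟩ := mem_image.1 hρ
    simp only [closedOutNeighbors, mem_filter] at hw
    have hwv := hw.1
    simp only [vertices, mem_filter, mem_univ, true_and] at hwv hv
    simp only [mem_biUnion, mem_filter, mem_univ, true_and, mem_image, mem_compl]
    obtain ⟨⟨l, hl⟩, -⟩ := hwv
    refine ⟨w.1.1, ⟨w.2, l, hl⟩, w.1.2, ?_, rfl⟩
    rcases hw.2 with rfl | h
    · exact hv.2
    · exact h.1
  refine (card_le_card hsub).trans (card_biUnion_le.trans (sum_le_sum fun f _ => ?_))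
  refine card_image_le.trans ?_
  rw [card_compl, hC, Fintype.card_fin]

/-! ### Uniformly random subsets of fixed size -/

/-- The probability of `s` under the uniform distribution on subsets of size `k`. -/
noncomputable def subsetWeight (B k : ℕ) (s : Finset (Fin B)) : ℝ :=
  if s.card = k then ((B.choose k : ℕ) : ℝ)⁻¹ else 0

theorem subsetWeight_nonneg (B k : ℕ) (s : Finset (Fin B)) : 0 ≤ subsetWeight B k s := by
  unfold subsetWeight; split_ifs <;> positivity

theorem sum_subsetWeight {k : ℕ} (hk : k ≤ B) : ∑ s, subsetWeight B k s = 1 := by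
  have h : (univ.filter fun s : Finset (Fin B) => s.card = k).card = B.choose k := by
    rw [← Fintype.card_subtype, Fintype.card_finset_len, Fintype.card_fin]
  simp only [subsetWeight]
  rw [← sum_filter, sum_const, h, nsmul_eq_mul, mul_inv_cancel₀]
  exact_mod_cast (Nat.choose_pos hk).ne'

theorem subsetWeight_mul_card (k : ℕ) (s : Finset (Fin B)) :
    subsetWeight B k s * s.card = subsetWeight B k s * k := by
  unfold subsetWeight; split_ifs with h <;> simp [h]

/-- The mean of `g` over a uniformly random subset of size `k`. -/
noncomputable def subsetMean (B k : ℕ) (g : Finset (Fin B) → ℝ) : ℝ :=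
  ∑ s, subsetWeight B k s * g s

/-- Exchangeability: it yields the first two moments without binomial identities. -/
theorem subsetMean_perm (k : ℕ) (σ : Equiv.Perm (Fin B)) (g : Finset (Fin B) → ℝ) :
    subsetMean B k (fun s => g (s.map σ.toEmbedding)) = subsetMean B k g := by
  refine Fintype.sum_equiv σ.finsetCongr _ _ fun s => ?_
  simp [subsetWeight, Equiv.finsetCongr]

theorem subsetMean_congr (k : ℕ) {g h : Finset (Fin B) → ℝ} (H : ∀ s, g s = h s) :
    subsetMean B k g = subsetMean B k h := by
  rw [funext H]

theorem subsetMean_sum {ι : Type*} (k : ℕ) (t : Finset ι) (g : ι → Finset (Fin B) → ℝ) :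
    subsetMean B k (fun s => ∑ i ∈ t, g i s) = ∑ i ∈ t, subsetMean B k (g i) := by
  simp only [subsetMean, mul_sum]
  exact sum_comm

/-- The indicator of membership. -/
def memInd (b : Fin B) (s : Finset (Fin B)) : ℝ := if b ∈ s then 1 else 0

theorem memInd_mul_self (b : Fin B) (s : Finset (Fin B)) : memInd b s * memInd b s = memInd b s := by
  unfold memInd; split_ifs <;> norm_num

theorem sum_memInd (s : Finset (Fin B)) : ∑ b, memInd b s = s.card := by
  simp [memInd]

theorem memInd_map (σ : Equiv.Perm (Fin B)) (b : Fin B) (s : Finset (Fin B)) :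
    memInd b (s.map σ.toEmbedding) = memInd (σ.symm b) s := by
  unfold memInd
  simp only [mem_map_equiv]

theorem subsetMean_memInd {k : ℕ} (hk : k ≤ B) (b : Fin B) :
    subsetMean B k (memInd b) = k / B := by
  have hB : (0 : ℝ) < B := by exact_mod_cast b.pos
  have hconst : ∀ a, subsetMean B k (memInd a) = subsetMean B k (memInd b) := by
    intro a
    rw [← subsetMean_perm k (Equiv.swap a b) (memInd a)]
    exact subsetMean_congr k fun s => by rw [memInd_map]; simp
  have hsum : ∑ a : Fin B, subsetMean B k (memInd a) = k := by
    rw [← subsetMean_sum]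
    simp only [subsetMean, sum_memInd, subsetWeight_mul_card]
    rw [← sum_mul, sum_subsetWeight hk, one_mul]
  simp only [hconst, sum_const, card_univ, Fintype.card_fin, nsmul_eq_mul] at hsum
  rw [eq_div_iff hB.ne', mul_comm, hsum]

/-- By symmetry the joint probability is the same for all `c ≠ a`; summing over `c` gives `(B - 1)`
times it equal to `(k - 1) * (k / B)`, and `k ≤ B` does the rest. -/
theorem subsetMean_memInd_mul_le {k : ℕ} (hk : k ≤ B) {a b : Fin B} (hab : a ≠ b) :
    subsetMean B k (fun s => memInd a s * memInd b s) ≤ (k / B : ℝ) ^ 2 := by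
  have hB1 : 1 < B := by
    have := a.2; have := b.2
    by_contra h
    exact hab (Fin.ext (by omega))
  have hB : (1 : ℝ) < B := by exact_mod_cast hB1
  have hconst : ∀ c ∈ univ.erase a, subsetMean B k (fun s => memInd a s * memInd c s) =
      subsetMean B k (fun s => memInd a s * memInd b s) := by
    intro c hc
    have hca : a ≠ c := (ne_of_mem_erase hc).symm
    rw [← subsetMean_perm k (Equiv.swap c b)]
    refine subsetMean_congr k fun s => ?_
    rw [memInd_map, memInd_map, Equiv.symm_swap, Equiv.swap_apply_left,
      Equiv.swap_apply_of_ne_of_ne hca hab]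
  have hsum : ∑ c ∈ univ.erase a, subsetMean B k (fun s => memInd a s * memInd c s) =
      (k - 1) * (k / B) := by
    rw [← subsetMean_sum, ← subsetMean_memInd hk a]
    simp only [subsetMean]
    rw [mul_sum]
    refine sum_congr rfl fun s _ => ?_
    rw [← mul_sum, sum_erase_eq_sub (mem_univ a), sum_memInd, mul_sub, memInd_mul_self]
    linear_combination memInd a s * subsetWeight_mul_card k s
  rw [sum_congr rfl hconst, sum_const, card_erase_of_mem (mem_univ a), card_univ,
    Fintype.card_fin, nsmul_eq_mul, Nat.cast_sub hB1.le, Nat.cast_one] at hsum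
  have hkB : (k : ℝ) ≤ B := by exact_mod_cast hk
  have h1 : ((k : ℝ) - 1) * (k / B) ≤ (B - 1) * (k / B) ^ 2 := by
    have h2 : (B - 1 : ℝ) * (k / B) ^ 2 - (k - 1) * (k / B) = (k / B) * ((B - k) / B) := by
      field_simp; ring
    have h3 : (0 : ℝ) ≤ (k / B) * ((B - k) / B) := by
      have : (0 : ℝ) ≤ B - k := by linarith
      positivity
    linarith
  rw [← hsum] at h1
  exact le_of_mul_le_mul_left h1 (by linarith)

/-- The indicator that `b` belongs to `s` exactly if `P` holds. -/
def iffInd (P : Prop) [Decidable P] (b : Fin B) (s : Finset (Fin B)) : ℝ :=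
  if b ∈ s ↔ P then 1 else 0

theorem iffInd_eq (P : Prop) [Decidable P] (b : Fin B) (s : Finset (Fin B)) :
    iffInd P b s = if P then memInd b s else 1 - memInd b s := by
  unfold iffInd memInd
  by_cases hP : P <;> by_cases hb : b ∈ s <;> simp [hP, hb]

theorem iffInd_nonneg (P : Prop) [Decidable P] (b : Fin B) (s : Finset (Fin B)) :
    0 ≤ iffInd P b s := by
  unfold iffInd; split_ifs <;> norm_num

theorem subsetMean_nonneg (k : ℕ) {g : Finset (Fin B) → ℝ} (hg : ∀ s, 0 ≤ g s) :
    0 ≤ subsetMean B k g :=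
  sum_nonneg fun s _ => mul_nonneg (subsetWeight_nonneg B k s) (hg s)

theorem subsetMean_iffInd {k : ℕ} (hk : k ≤ B) (P : Prop) [Decidable P] (b : Fin B) :
    subsetMean B k (iffInd P b) = if P then (k / B : ℝ) else 1 - k / B := by
  rw [subsetMean_congr k (iffInd_eq P b)]
  split_ifs
  · exact subsetMean_memInd hk b
  · rw [← subsetMean_memInd hk b]
    simp only [subsetMean, mul_sub, mul_one, sum_sub_distrib, sum_subsetWeight hk]

theorem subsetMean_iffInd_mul_le {k : ℕ} (hk : k ≤ B) (P : Prop) [Decidable P] {a b : Fin B}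
    (hab : a ≠ b) :
    subsetMean B k (fun s => iffInd P a s * iffInd P b s) ≤
      (if P then (k / B : ℝ) else 1 - k / B) ^ 2 := by
  have h := subsetMean_memInd_mul_le hk hab
  simp only [iffInd_eq]
  split_ifs
  · exact h
  -- Complementing both indicators leaves their covariance unchanged.
  · have key : subsetMean B k (fun s => (1 - memInd a s) * (1 - memInd b s)) =
        ∑ s, subsetWeight B k s - subsetMean B k (memInd a) - subsetMean B k (memInd b) +
          subsetMean B k (fun s => memInd a s * memInd b s) := by
      simp only [subsetMean, ← sum_sub_distrib, ← sum_add_distrib]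
      exact sum_congr rfl fun s _ => by ring
    rw [key, sum_subsetWeight hk, subsetMean_memInd hk, subsetMean_memInd hk]
    linarith

/-! ### Moments under the random placement -/

theorem sum_pi_prod {ι : Type*} [Fintype ι] [DecidableEq ι] {α : Type*} [Fintype α]
    (g : ι → α → ℝ) : ∑ x : ι → α, ∏ i, g i (x i) = ∏ i, ∑ a, g i a := by
  rw [Finset.prod_univ_sum, Fintype.piFinset_univ]

theorem placementProb_eq (M : ℝ) (p : Fin m → ℝ) (C : Placement n m B) :
    placementProb M p C = ∏ u, ∏ f, subsetWeight B (cachedCount M p B f) (C u f) := rfl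

theorem placementProb_nonneg (M : ℝ) (p : Fin m → ℝ) (C : Placement n m B) :
    0 ≤ placementProb M p C :=
  prod_nonneg fun _ _ => prod_nonneg fun _ _ => subsetWeight_nonneg _ _ _

/-- The mean of `X` under RAP caching. -/
noncomputable def rapMean (M : ℝ) (p : Fin m → ℝ) (X : Placement n m B → ℝ) : ℝ :=
  ∑ C, placementProb M p C * X C

theorem rapMean_prod {M : ℝ} {p : Fin m → ℝ} (hk : ∀ f, cachedCount M p B f ≤ B) (f : Fin m)
    (g : Fin n → Finset (Fin B) → ℝ) :
    rapMean M p (fun C => ∏ u, g u (C u f)) =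
      ∏ u, subsetMean B (cachedCount M p B f) (g u) := by
  -- The factor `1` at the other files makes the summand a product over all pairs of user and file,
  -- so that the sum factorizes.
  have h1 : ∀ C : Placement n m B, placementProb M p C * ∏ u, g u (C u f) =
      ∏ u, ∏ f', subsetWeight B (cachedCount M p B f') (C u f') *
        (if f' = f then g u (C u f') else 1) := by
    intro C
    rw [placementProb_eq, ← prod_mul_distrib]
    refine prod_congr rfl fun u _ => ?_
    rw [prod_mul_distrib, prod_ite_eq' univ f, if_pos (mem_univ f)]
  simp only [rapMean, h1]
  rw [sum_pi_prod (fun (u : Fin n) (row : Fin m → Finset (Fin B)) =>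
    ∏ f', subsetWeight B (cachedCount M p B f') (row f') * (if f' = f then g u (row f') else 1))]
  refine prod_congr rfl fun u _ => ?_
  rw [sum_pi_prod (fun (f' : Fin m) (s : Finset (Fin B)) =>
    subsetWeight B (cachedCount M p B f') s * (if f' = f then g u s else 1))]
  rw [prod_eq_single f]
  · simp [subsetMean]
  · intro f' _ hne
    simp [hne, sum_subsetWeight (hk f')]
  · simp

theorem sum_placementProb {M : ℝ} {p : Fin m → ℝ} (hk : ∀ f, cachedCount M p B f ≤ B) :
    ∑ C : Placement n m B, placementProb M p C = 1 := by
  simp only [placementProb_eq]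
  rw [sum_pi_prod (fun (u : Fin n) (row : Fin m → Finset (Fin B)) =>
    ∏ f', subsetWeight B (cachedCount M p B f') (row f'))]
  refine prod_eq_one fun u _ => ?_
  rw [sum_pi_prod (fun (f' : Fin m) (s : Finset (Fin B)) =>
    subsetWeight B (cachedCount M p B f') s)]
  exact prod_eq_one fun f _ => sum_subsetWeight (hk f)

/-- The probability that a fixed packet is cached by exactly the users in `T`, if every user
caches it independently with probability `a`. -/
def exactProb (a : ℝ) (T : Finset (Fin n)) : ℝ := ∏ u, if u ∈ T then a else 1 - a

theorem exactProb_eq (a : ℝ) (T : Finset (Fin n)) :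
    exactProb a T = a ^ T.card * (1 - a) ^ (n - T.card) := by
  unfold exactProb
  rw [prod_ite]
  simp [filter_not, card_sdiff]

theorem exactProb_nonneg {a : ℝ} (h0 : 0 ≤ a) (h1 : a ≤ 1) (T : Finset (Fin n)) :
    0 ≤ exactProb a T :=
  prod_nonneg fun u _ => by split_ifs <;> linarith

theorem exactProb_le_one {a : ℝ} (h0 : 0 ≤ a) (h1 : a ≤ 1) (T : Finset (Fin n)) :
    exactProb a T ≤ 1 :=
  prod_le_one (fun u _ => by split_ifs <;> linarith) (fun u _ => by split_ifs <;> linarith)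

theorem exactCount_eq_sum (C : Placement n m B) (f : Fin m) (T : Finset (Fin n)) :
    (exactCount C f T : ℝ) = ∑ b, ∏ u, iffInd (u ∈ T) b (C u f) := by
  unfold exactCount
  rw [card_filter, Nat.cast_sum]
  refine sum_congr rfl fun b _ => ?_
  unfold iffInd
  by_cases h : ∀ u, b ∈ C u f ↔ u ∈ T
  · simp [h]
  · rw [if_neg h]
    push Not at h
    obtain ⟨u, hu⟩ := h
    rw [prod_eq_zero (mem_univ u), Nat.cast_zero]
    rw [if_neg]
    tauto

theorem rapMean_sum {ι : Type*} (M : ℝ) (p : Fin m → ℝ) (t : Finset ι)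
    (X : ι → Placement n m B → ℝ) :
    rapMean M p (fun C => ∑ i ∈ t, X i C) = ∑ i ∈ t, rapMean M p (X i) := by
  simp only [rapMean, mul_sum]
  exact sum_comm

/-- Off-diagonal second moments are at most `π ^ 2`, and each of the `B` diagonal terms exceeds this
by at most `1`; the terms in `π ^ 2` then cancel. -/
theorem rapMean_sq_sub_le {M : ℝ} {p : Fin m → ℝ} (hk : ∀ f, cachedCount M p B f ≤ B) (f : Fin m)
    (T : Finset (Fin n)) :
    rapMean M p (fun C : Placement n m B =>
      ((exactCount C f T : ℝ) - B * exactProb (cachedCount M p B f / B : ℝ) T) ^ 2) ≤ B := by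
  set k := cachedCount M p B f with hkdef
  set π := exactProb (k / B : ℝ) T with hπ
  have hkB : (k : ℝ) ≤ B := by exact_mod_cast hk f
  have ha0 : (0 : ℝ) ≤ k / B := by positivity
  have ha1 : (k / B : ℝ) ≤ 1 := div_le_one_of_le₀ hkB (by positivity)
  have hπ0 := exactProb_nonneg ha0 ha1 T
  have hπ1 := exactProb_le_one ha0 ha1 T
  rw [← hπ] at hπ0 hπ1
  let Y : Fin B → Placement n m B → ℝ := fun b C => ∏ u, iffInd (u ∈ T) b (C u f)
  have hY : ∀ b, rapMean M p (Y b) = π := by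
    intro b
    rw [rapMean_prod hk f]
    exact prod_congr rfl fun u _ => subsetMean_iffInd (hk f) _ b
  have hYY : ∀ a b, rapMean M p (fun C => Y a C * Y b C) ≤ π ^ 2 + if a = b then 1 else 0 := by
    intro a b
    split_ifs with hab
    · subst hab
      have : ∀ C, Y a C * Y a C = Y a C := by
        intro C
        simp only [Y, ← prod_mul_distrib]
        refine prod_congr rfl fun u _ => ?_
        unfold iffInd; split_ifs <;> norm_num
      simp only [this]
      rw [hY]
      nlinarith
    · have : ∀ C, Y a C * Y b C =
          ∏ u, (fun s => iffInd (u ∈ T) a s * iffInd (u ∈ T) b s) (C u f) := by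
        intro C
        simp only [Y, ← prod_mul_distrib]
      simp only [this]
      rw [rapMean_prod hk f (fun u s => iffInd (u ∈ T) a s * iffInd (u ∈ T) b s), add_zero, hπ,
        exactProb, ← prod_pow]
      refine prod_le_prod (fun u _ => ?_) fun u _ => subsetMean_iffInd_mul_le (hk f) _ hab
      exact subsetMean_nonneg _ fun s => mul_nonneg (iffInd_nonneg _ _ _) (iffInd_nonneg _ _ _)
  have hX : ∀ C : Placement n m B, (exactCount C f T : ℝ) = ∑ b, Y b C :=
    fun C => exactCount_eq_sum C f T
  have hexp : rapMean M p (fun C : Placement n m B => ((exactCount C f T : ℝ) - B * π) ^ 2) =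
      ∑ a, ∑ b, rapMean M p (fun C => Y a C * Y b C) - 2 * (B * π) * ∑ b, rapMean M p (Y b) +
        (B * π) ^ 2 := by
    simp only [← rapMean_sum]
    -- Total mass one turns the constant into a mean, so the identity can be checked placement by
    -- placement.
    rw [← one_mul ((B * π) ^ 2), ← sum_placementProb (n := n) hk, sum_mul]
    simp only [rapMean]
    rw [mul_sum, ← sum_sub_distrib, ← sum_add_distrib]
    refine sum_congr rfl fun C _ => ?_
    rw [hX, ← sum_mul_sum]
    ring
  rw [hexp]
  have h2 : ∑ a, ∑ b, rapMean M p (fun C => Y a C * Y b C) ≤ B * (B * π ^ 2 + 1) := by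
    calc _ ≤ ∑ a : Fin B, ∑ b : Fin B, (π ^ 2 + if a = b then 1 else 0) :=
          sum_le_sum fun a _ => sum_le_sum fun b _ => hYY a b
      _ = _ := by simp [sum_add_distrib, mul_add]
  simp only [hY, sum_const, card_univ, Fintype.card_fin, nsmul_eq_mul]
  nlinarith

open Classical in
-- Chebyshev's inequality; only the upper tail is needed.
theorem rapProb_exactCount_gt_le {M : ℝ} {p : Fin m → ℝ} (hB : 0 < B)
    (hk : ∀ f, cachedCount M p B f ≤ B) (f : Fin m) (T : Finset (Fin n)) {δ : ℝ} (hδ : 0 < δ) :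
    rapProb M p (fun C : Placement n m B =>
      B * (exactProb (cachedCount M p B f / B : ℝ) T + δ) < exactCount C f T) ≤
        1 / (δ ^ 2 * B) := by
  have hB' : (0 : ℝ) < B := by exact_mod_cast hB
  have h := rapMean_sq_sub_le (n := n) hk f T
  set π := exactProb (cachedCount M p B f / B : ℝ) T
  have h1 : (δ * B) ^ 2 * rapProb M p (fun C : Placement n m B =>
      B * (π + δ) < exactCount C f T) ≤ B := by
    refine le_trans ?_ h
    rw [rapProb, mul_sum]
    refine sum_le_sum fun C _ => ?_
    have hp := placementProb_nonneg M p C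
    split_ifs with hC
    · rw [mul_comm]
      refine mul_le_mul_of_nonneg_left ?_ hp
      refine pow_le_pow_left₀ (by positivity) ?_ 2
      linarith
    · rw [mul_zero]
      exact mul_nonneg hp (sq_nonneg _)
  rw [le_div_iff₀ (by positivity)]
  refine le_of_mul_le_mul_right (a := (B : ℝ)) ?_ hB'
  linarith

open Classical in
-- Union bound. Restricting `hE` to placements of nonzero probability makes the exact cache sizes
-- available there.
theorem one_sub_le_rapProb_forall {ι : Type*} [Fintype ι] {M : ℝ} {p : Fin m → ℝ}
    (hk : ∀ f, cachedCount M p B f ≤ B) (E : Placement n m B → Prop)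
    (bad : ι → Placement n m B → Prop)
    (hE : ∀ C, placementProb M p C ≠ 0 → (∀ i, ¬ bad i C) → E C) :
    1 - ∑ i, rapProb M p (bad i) ≤ rapProb M p E := by
  rw [sub_le_iff_le_add, ← sum_placementProb (n := n) hk]
  simp only [rapProb]
  rw [sum_comm, ← sum_add_distrib]
  refine sum_le_sum fun C _ => ?_
  have hp := placementProb_nonneg M p C
  have hs : ∀ i ∈ (univ : Finset ι), 0 ≤ if bad i C then placementProb M p C else 0 := by
    intro i _; split_ifs <;> simp [hp]
  by_cases hEC : E C
  · rw [if_pos hEC]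
    linarith [sum_nonneg hs]
  rw [if_neg hEC, zero_add]
  by_cases h0 : placementProb M p C = 0
  · rw [h0]; simp
  by_cases hb : ∀ i, ¬ bad i C
  · exact absurd (hE C h0 hb) hEC
  push Not at hb
  obtain ⟨i, hi⟩ := hb
  calc placementProb M p C = if bad i C then placementProb M p C else 0 := by rw [if_pos hi]
    _ ≤ _ := single_le_sum hs (mem_univ i)

theorem rapProb_le_one {M : ℝ} {p : Fin m → ℝ} (hk : ∀ f, cachedCount M p B f ≤ B)
    (E : Placement n m B → Prop) : rapProb M p E ≤ 1 := by
  rw [← sum_placementProb (n := n) hk]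
  refine sum_le_sum fun C _ => ?_
  split_ifs
  · exact le_rfl
  · exact placementProb_nonneg M p C

/-! ### Averages over the random demands -/

theorem demandProb_nonneg {q : Fin m → ℝ} (hq0 : ∀ f, 0 ≤ q f) (F : Demand n m L) :
    0 ≤ demandProb q F :=
  prod_nonneg fun _ _ => prod_nonneg fun _ _ => hq0 _

theorem sum_demandProb_mul_prod (q g : Fin m → ℝ) :
    ∑ F : Demand n m L, demandProb q F * ∏ u, ∏ l, g (F u l) = (∑ f, q f * g f) ^ (n * L) := by
  simp only [demandProb, ← prod_mul_distrib]
  rw [sum_pi_prod (fun (_ : Fin n) (x : Fin L → Fin m) => ∏ l, q (x l) * g (x l))]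
  rw [sum_pi_prod (fun (_ : Fin L) (a : Fin m) => q a * g a)]
  simp [← pow_mul, mul_comm]

theorem sum_demandProb {q : Fin m → ℝ} (hq1 : ∑ f, q f = 1) :
    ∑ F : Demand n m L, demandProb q F = 1 := by
  simpa [hq1] using sum_demandProb_mul_prod (n := n) (L := L) q (fun _ => 1)

theorem sum_demandProb_requested {q : Fin m → ℝ} (hq1 : ∑ f, q f = 1) (f : Fin m) :
    ∑ F : Demand n m L, demandProb q F * (if ∃ u l, F u l = f then 1 else 0) =
      1 - (1 - q f) ^ (n * L) := by
  have h : ∀ F : Demand n m L, (if ∃ u l, F u l = f then (1 : ℝ) else 0) =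
      1 - ∏ u, ∏ l, (if F u l = f then 0 else 1 : ℝ) := by
    intro F
    split_ifs with hF
    · obtain ⟨u, l, hul⟩ := hF
      have h0 : ∏ u, ∏ l, (if F u l = f then 0 else 1 : ℝ) = 0 :=
        prod_eq_zero (mem_univ u) (prod_eq_zero (mem_univ l) (if_pos hul))
      rw [h0, sub_zero]
    · push Not at hF
      simp [hF]
  simp only [h, mul_sub, mul_one, sum_sub_distrib, sum_demandProb hq1]
  rw [sum_demandProb_mul_prod q (fun a => if a = f then 0 else 1)]
  have : ∑ a, q a * (if a = f then 0 else 1) = 1 - q f := by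
    have h1 : ∑ a ∈ univ.erase f, q a = 1 - q f := by
      rw [sum_erase_eq_sub (mem_univ f), hq1]
    rw [← h1, ← sum_erase univ (a := f) (by simp)]
    exact sum_congr rfl fun a ha => by rw [if_neg (ne_of_mem_erase ha), mul_one]
  rw [this]

/-- Marginalization: distinct coordinates of an i.i.d. family are again i.i.d. -/
theorem sum_prod_mul_comp {ι κ α : Type*} [Fintype ι] [Fintype κ] [DecidableEq ι] [DecidableEq κ]
    [Fintype α] [DecidableEq α] {q : α → ℝ} (hq1 : ∑ a, q a = 1) {e : κ → ι}
    (he : Function.Injective e) (g : (κ → α) → ℝ) :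
    ∑ x : ι → α, (∏ i, q (x i)) * g (fun j => x (e j)) = ∑ d : κ → α, (∏ j, q (d j)) * g d := by
  -- The indicator of `d = x ∘ e` is spread over the coordinates of `x`, so the sum over `x`
  -- factorizes; coordinates outside the range of `e` contribute `∑ a, q a = 1`.
  have h1 : ∀ x : ι → α, (∏ i, q (x i)) * g (fun j => x (e j)) =
      ∑ d : κ → α, g d * ∏ i, q (x i) * if ∀ j, e j = i → x i = d j then 1 else 0 := by
    intro x
    rw [sum_eq_single (fun j => x (e j))]
    · rw [mul_comm]
      congr 1
      refine prod_congr rfl fun i _ => ?_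
      rw [if_pos, mul_one]
      rintro j rfl
      rfl
    · intro d _ hd
      obtain ⟨j, hj⟩ := Function.ne_iff.1 hd
      rw [prod_eq_zero (mem_univ (e j)), mul_zero]
      rw [if_neg, mul_zero]
      intro h
      exact hj (h j rfl).symm
    · simp
  simp only [h1]
  rw [sum_comm]
  refine sum_congr rfl fun d _ => ?_
  rw [← mul_sum, mul_comm]
  congr 1
  rw [sum_pi_prod (fun i a => q a * if ∀ j, e j = i → a = d j then 1 else 0)]
  rw [← prod_subset (subset_univ (univ.image e)), prod_image he.injOn]
  · refine prod_congr rfl fun j _ => ?_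
    rw [sum_eq_single (d j)]
    · rw [if_pos, mul_one]
      intro j' hj'
      rw [he hj']
    · intro a _ ha
      rw [if_neg fun h => ha (h j rfl), mul_zero]
    · simp
  · intro i _ hi
    have : ∀ a, ∀ j, e j = i → a = d j := by
      rintro a j rfl
      exact absurd (mem_image_of_mem e (mem_univ j)) hi
    refine (sum_congr rfl fun a _ => ?_).trans hq1
    rw [if_pos (this a), mul_one]

theorem sum_demandProb_mul_comp {q : Fin m → ℝ} (hq1 : ∑ f, q f = 1) {ℓ : ℕ}
    {e : Fin ℓ → Fin n} (he : Function.Injective e) (l : Fin L) (g : (Fin ℓ → Fin m) → ℝ) :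
    ∑ F : Demand n m L, demandProb q F * g (fun i => F (e i) l) =
      ∑ d : Fin ℓ → Fin m, (∏ i, q (d i)) * g d := by
  rw [← sum_prod_mul_comp hq1 (e := fun i => (e i, l))
    (fun i j hij => he (Prod.ext_iff.1 hij).1) g]
  refine Fintype.sum_equiv (Equiv.curry (Fin n) (Fin L) (Fin m)).symm _ _ fun F => ?_
  simp [demandProb, Fintype.prod_prod_type]

/-! ### The largest weight among several demands -/

theorem exists_isArgmax (M : ℝ) (p : Fin m → ℝ) {ℓ : ℕ} (d : Fin ℓ → Fin m) (i : Fin ℓ) :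
    ∃ f, IsArgmax n M p ℓ d f := by
  -- The lexicographic order with the index reversed encodes the tie-breaking rule.
  obtain ⟨j, -, hj⟩ := exists_max_image univ
    (fun j => toLex (weight n M p ℓ (d j), OrderDual.toDual (d j))) ⟨i, mem_univ i⟩
  refine ⟨d j, ⟨j, rfl⟩, fun i => ?_⟩
  have h := hj i (mem_univ i)
  rw [Prod.Lex.toLex_le_toLex] at h
  rcases h with h | ⟨h, h'⟩
  · exact ⟨h.le, fun e => absurd e h.ne⟩
  · exact ⟨h.le, fun _ => h'⟩

open Classical in
/-- The weight of the maximizing file among the demands `d`. -/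
noncomputable def maxWeight (n : ℕ) (M : ℝ) (p : Fin m → ℝ) (ℓ : ℕ) (d : Fin ℓ → Fin m) : ℝ :=
  ∑ f, if IsArgmax n M p ℓ d f then weight n M p ℓ f else 0

theorem weight_nonneg {M : ℝ} {p : Fin m → ℝ} {f : Fin m} (h0 : 0 ≤ p f * M) (h1 : p f * M ≤ 1)
    (ℓ : ℕ) : 0 ≤ weight n M p ℓ f :=
  mul_nonneg (pow_nonneg (by linarith) _) (pow_nonneg h0 _)

/-- Existence of a maximizing file suffices: the remaining terms of `maxWeight` are nonnegative, so
uniqueness is not needed. -/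
theorem weight_le_maxWeight {M : ℝ} {p : Fin m → ℝ} (h0 : ∀ f, 0 ≤ p f * M)
    (h1 : ∀ f, p f * M ≤ 1) {ℓ : ℕ} (d : Fin ℓ → Fin m) (i : Fin ℓ) :
    weight n M p ℓ (d i) ≤ maxWeight n M p ℓ d := by
  classical
  obtain ⟨f, hf⟩ := exists_isArgmax (n := n) M p d i
  refine (hf.2 i).1.trans ?_
  rw [maxWeight]
  refine le_trans (le_of_eq (if_pos hf).symm) (single_le_sum
    (f := fun f => if IsArgmax n M p ℓ d f then weight n M p ℓ f else 0) (fun f _ => ?_)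
    (mem_univ f))
  split_ifs
  · exact weight_nonneg (h0 f) (h1 f) ℓ
  · exact le_rfl

theorem sum_mul_maxWeight (M : ℝ) (q p : Fin m → ℝ) (ℓ : ℕ) :
    ∑ d : Fin ℓ → Fin m, (∏ i, q (d i)) * maxWeight n M p ℓ d =
      ∑ f, rho n M q p f ℓ * weight n M p ℓ f := by
  simp only [maxWeight, rho, mul_sum, sum_mul]
  rw [sum_comm]
  refine sum_congr rfl fun f _ => sum_congr rfl fun d _ => ?_
  split_ifs <;> simp

/-- The sum over all nonempty sets of users and all request indices of the largest weight. -/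
noncomputable def totalMaxWeight (M : ℝ) (p : Fin m → ℝ) (F : Demand n m L) : ℝ :=
  ∑ A : Finset (Fin n) with A.Nonempty, ∑ l,
    maxWeight n M p A.card fun i => F (A.orderEmbOfFin rfl i) l

/-- For fixed `l`, the demands of the users in `A` are `A.card` i.i.d. draws, so only the size of
`A` matters; counting sets by size produces the binomials. -/
theorem sum_demandProb_mul_totalMaxWeight (M : ℝ) {q : Fin m → ℝ} (p : Fin m → ℝ)
    (hq1 : ∑ f, q f = 1) :
    ∑ F : Demand n m L, demandProb q F * totalMaxWeight M p F = psi n L M q p := by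
  simp only [totalMaxWeight, mul_sum]
  rw [sum_comm]
  have h : ∀ A : Finset (Fin n), ∑ F : Demand n m L, ∑ l, demandProb q F *
      maxWeight n M p A.card (fun i => F (A.orderEmbOfFin rfl i) l) =
        L * ∑ f, rho n M q p f A.card * weight n M p A.card f := by
    intro A
    rw [sum_comm]
    simp only [sum_demandProb_mul_comp hq1 (A.orderEmbOfFin rfl).injective,
      sum_mul_maxWeight, sum_const, card_univ, Fintype.card_fin, nsmul_eq_mul]
  simp only [h]
  rw [← mul_sum, psi]
  congr 1
  set w : ℕ → ℝ := fun ℓ => ∑ f, rho n M q p f ℓ * weight n M p ℓ f with hw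
  -- The value `0` at `ℓ = 0` drops the empty set, matching the range of `psi`.
  have h2 := sum_powerset_apply_card (fun ℓ => if ℓ = 0 then 0 else w ℓ) (x := (univ : Finset (Fin n)))
  rw [powerset_univ, card_univ, Fintype.card_fin] at h2
  rw [sum_filter]
  calc _ = ∑ A : Finset (Fin n), if A.card = 0 then 0 else w A.card := by
        refine sum_congr rfl fun A _ => ?_
        rcases A.eq_empty_or_nonempty with rfl | hA
        · simp
        · rw [if_pos hA, if_neg (card_pos.2 hA).ne']
    _ = _ := h2
    _ = _ := by
        have hsub : Icc 1 n ⊆ range (n + 1) := by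
          intro ℓ hℓ
          rw [mem_Icc] at hℓ
          rw [mem_range]
          omega
        rw [← sum_subset hsub]
        · refine sum_congr rfl fun ℓ hℓ => ?_
          rw [if_neg (by rw [mem_Icc] at hℓ; omega), nsmul_eq_mul]
          rfl
        · intro ℓ hℓ hℓ'
          rw [mem_range] at hℓ
          rw [mem_Icc] at hℓ'
          rw [if_pos (by omega), smul_zero]

/-! ### The rate for typical placements -/

theorem cast_sup_le {ι : Type*} (s : Finset ι) (g : ι → ℕ) {r : ℝ} (hr : 0 ≤ r)
    (h : ∀ i ∈ s, (g i : ℝ) ≤ r) : ((s.sup g : ℕ) : ℝ) ≤ r := by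
  rw [← Nat.le_floor_iff hr]
  exact Finset.sup_le fun i hi => (Nat.le_floor_iff hr).2 (h i hi)

theorem exactProb_erase (M : ℝ) (p : Fin m → ℝ) {A : Finset (Fin n)} {u : Fin n} (hu : u ∈ A)
    (f : Fin m) : exactProb (p f * M) (A.erase u) = weight n M p A.card f := by
  have h1 : 0 < A.card := card_pos.2 ⟨u, hu⟩
  have h2 : A.card ≤ n := by simpa using card_le_univ A
  rw [exactProb_eq, weight, card_erase_of_mem hu, mul_comm]
  congr 2
  omega

/-- The largest sum over requests is at most the sum of the largest weights, request by request. The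
error is `δ` for each of the `L` requests and `2 ^ n` labels. -/
theorem labelBound_le {M : ℝ} {p : Fin m → ℝ} (h0 : ∀ f, 0 ≤ p f * M) (h1 : ∀ f, p f * M ≤ 1)
    {δ : ℝ} (hδ : 0 ≤ δ) {C : Placement n m B}
    (hC : ∀ f T, (exactCount C f T : ℝ) ≤ B * (exactProb (p f * M) T + δ)) (F : Demand n m L) :
    (labelBound C (vertices C F) : ℝ) ≤ B * (totalMaxWeight M p F + 2 ^ n * (L * δ)) := by
  have hA : ∀ A : Finset (Fin n),
      ((univ.sup fun u => (labelUser C (vertices C F) A u).card : ℕ) : ℝ) ≤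
        B * ((if A.Nonempty then ∑ l, maxWeight n M p A.card fun i => F (A.orderEmbOfFin rfl i) l
          else 0) + L * δ) := by
    intro A
    have hmax : ∀ u ∈ A, ∀ l, weight n M p A.card (F u l) ≤
        maxWeight n M p A.card fun i => F (A.orderEmbOfFin rfl i) l := by
      intro u hu l
      obtain ⟨i, rfl⟩ : u ∈ Set.range (A.orderEmbOfFin rfl) := by
        rw [range_orderEmbOfFin]; exact hu
      exact weight_le_maxWeight h0 h1 (fun i => F (A.orderEmbOfFin rfl i) l) i
    have hnn : 0 ≤ (if A.Nonempty then
        ∑ l, maxWeight n M p A.card fun i => F (A.orderEmbOfFin rfl i) l else 0) := by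
      split_ifs with hne
      · obtain ⟨u, hu⟩ := hne
        exact sum_nonneg fun l _ => (weight_nonneg (h0 _) (h1 _) _).trans (hmax u hu l)
      · exact le_rfl
    refine cast_sup_le _ _ (by positivity) fun u _ => ?_
    by_cases hu : u ∈ A
    · rw [if_pos ⟨u, hu⟩]
      calc ((labelUser C (vertices C F) A u).card : ℝ)
          ≤ ∑ l, (exactCount C (F u l) (A.erase u) : ℝ) := by
            exact_mod_cast card_labelUser_vertices_le C F A hu
        _ ≤ ∑ l, (B * (maxWeight n M p A.card (fun i => F (A.orderEmbOfFin rfl i) l) + δ)) := by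
            refine sum_le_sum fun l _ => (hC _ _).trans ?_
            rw [exactProb_erase M p hu]
            have := hmax u hu l
            gcongr
        _ = _ := by
            rw [← mul_sum, sum_add_distrib]
            simp
    · rw [card_labelUser_of_notMem C _ A hu, Nat.cast_zero]
      positivity
  rw [labelBound, Nat.cast_sum]
  refine (sum_le_sum fun A _ => hA A).trans (le_of_eq ?_)
  rw [← mul_sum, sum_add_distrib, ← sum_filter, totalMaxWeight]
  simp

theorem localColors_packet_le_real {M : ℝ} {p : Fin m → ℝ} (hk : ∀ f, cachedCount M p B f ≤ B)
    {C : Placement n m B} (hC : ∀ u f, (C u f).card = cachedCount M p B f) (F : Demand n m L) :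
    (localColors C F (fun v => v.1) : ℝ) ≤
      ∑ f, (if ∃ u l, F u l = f then 1 else 0) * (B * (1 - p f * M) + 1) := by
  have h : (localColors C F (fun v => v.1) : ℝ) ≤
      ((∑ f with ∃ u l, F u l = f, (B - cachedCount M p B f) : ℕ) : ℝ) := by
    exact_mod_cast localColors_packet_le C F hC
  refine h.trans ?_
  rw [Nat.cast_sum, sum_filter]
  refine sum_le_sum fun f _ => ?_
  split_ifs
  · rw [Nat.cast_sub (hk f), one_mul]
    -- Rounding costs less than one packet per file, whence the term `m / B` in the rate.
    have := Nat.lt_floor_add_one (p f * M * B)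
    rw [cachedCount]
    linarith
  · simp

theorem rate_le_psi {M : ℝ} {q p : Fin m → ℝ} (hq0 : ∀ f, 0 ≤ q f) (hq1 : ∑ f, q f = 1)
    (h0 : ∀ f, 0 ≤ p f * M) (h1 : ∀ f, p f * M ≤ 1) (hB : 0 < B)
    {δ : ℝ} (hδ : 0 ≤ δ) {C : Placement n m B}
    (hC : ∀ f T, (exactCount C f T : ℝ) ≤ B * (exactProb (p f * M) T + δ))
    {c : Demand n m L → Vertex n m B → ℕ} (hc : ∀ F, IsGreedyColoring C F (c F)) :
    rate q C c ≤ psi n L M q p + 2 ^ n * (L * δ) := by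
  have hB' : (0 : ℝ) < B := by exact_mod_cast hB
  rw [rate, div_le_iff₀ hB']
  calc _ ≤ ∑ F : Demand n m L, demandProb q F *
        (B * (totalMaxWeight M p F + 2 ^ n * (L * δ))) := by
        refine sum_le_sum fun F _ => mul_le_mul_of_nonneg_left ?_ (demandProb_nonneg hq0 F)
        refine le_trans ?_ (labelBound_le h0 h1 hδ hC F)
        exact_mod_cast (min_le_left _ _).trans (localColors_le_labelBound (hc F))
    _ = (∑ F : Demand n m L, demandProb q F * totalMaxWeight M p F) * B +
        (∑ F : Demand n m L, demandProb q F) * (2 ^ n * (L * δ)) * B := by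
        rw [sum_mul, sum_mul, sum_mul, ← sum_add_distrib]
        exact sum_congr rfl fun F _ => by ring
    _ = _ := by
        rw [sum_demandProb_mul_totalMaxWeight M p hq1, sum_demandProb hq1]
        ring

theorem rate_le_mBar_sub {M : ℝ} {q p : Fin m → ℝ} (hq0 : ∀ f, 0 ≤ q f) (hq1 : ∑ f, q f = 1)
    (hB : 0 < B) (hk : ∀ f, cachedCount M p B f ≤ B) {C : Placement n m B}
    (hC : ∀ u f, (C u f).card = cachedCount M p B f) (c : Demand n m L → Vertex n m B → ℕ) :
    rate q C c ≤ mBar n L q - MBar n L M q p + m / B := by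
  have hB' : (0 : ℝ) < B := by exact_mod_cast hB
  have hqle : ∀ f, q f ≤ 1 := fun f => hq1 ▸ single_le_sum (fun f _ => hq0 f) (mem_univ f)
  rw [rate, div_le_iff₀ hB']
  calc _ ≤ ∑ F : Demand n m L, demandProb q F *
        ∑ f, (if ∃ u l, F u l = f then 1 else 0) * (B * (1 - p f * M) + 1) := by
        refine sum_le_sum fun F _ => mul_le_mul_of_nonneg_left ?_ (demandProb_nonneg hq0 F)
        refine le_trans ?_ (localColors_packet_le_real hk hC F)
        exact_mod_cast min_le_right _ _
    _ = ∑ f, (1 - (1 - q f) ^ (n * L)) * (B * (1 - p f * M) + 1) := by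
        simp only [mul_sum]
        rw [sum_comm]
        refine sum_congr rfl fun f _ => ?_
        rw [← sum_demandProb_requested hq1, sum_mul]
        exact sum_congr rfl fun F _ => by ring
    _ ≤ ∑ f, ((1 - (1 - q f) ^ (n * L)) * (1 - p f * M) * B + 1) := by
        refine sum_le_sum fun f _ => ?_
        have : 0 ≤ (1 - q f) ^ (n * L) := pow_nonneg (by linarith [hqle f]) _
        linarith
    _ = _ := by
        rw [sum_add_distrib, ← sum_mul, mBar, MBar, ← sum_sub_distrib, add_mul,
          div_mul_cancel₀ _ hB'.ne']
        congr 1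
        · congr 1
          exact sum_congr rfl fun f _ => by ring
        · simp

theorem card_eq_of_placementProb_ne_zero {M : ℝ} {p : Fin m → ℝ} {C : Placement n m B}
    (h : placementProb M p C ≠ 0) (u : Fin n) (f : Fin m) :
    (C u f).card = cachedCount M p B f := by
  by_contra hne
  exact h (prod_eq_zero (mem_univ u) (prod_eq_zero (mem_univ f) (if_neg hne)))

/-- Rounding disappears in the limit: `exactProb` is a polynomial in its first argument, and there
are finitely many `f` and `T`. -/
theorem eventually_exactProb_le {M : ℝ} {p : Fin m → ℝ} (h0 : ∀ f, 0 ≤ p f * M) {δ : ℝ}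
    (hδ : 0 < δ) : ∀ᶠ B : ℕ in atTop, ∀ f, ∀ T : Finset (Fin n),
      exactProb (cachedCount M p B f / B : ℝ) T ≤ exactProb (p f * M) T + δ := by
  rw [eventually_all]
  intro f
  rw [eventually_all]
  intro T
  have h1 : Tendsto (fun B : ℕ => (cachedCount M p B f / B : ℝ)) atTop (𝓝 (p f * M)) :=
    (tendsto_nat_floor_mul_div_atTop (h0 f)).comp tendsto_natCast_atTop_atTop
  have h2 : Continuous fun a : ℝ => exactProb a T := by
    simp only [exactProb_eq]
    fun_prop
  exact ((h2.tendsto _).comp h1).eventually_le_const (by simpa using hδ)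

end RapGclc

theorem theorem1 (n m L : ℕ) (M : ℝ) (hM : 0 < M) (q p : Fin m → ℝ)
    (hq0 : ∀ f, 0 ≤ q f) (hq1 : ∑ f, q f = 1)
    (hp0 : ∀ f, 0 ≤ p f) (hpM : ∀ f, p f ≤ 1 / M) (hp1 : ∑ f, p f = 1)
    (ε : ℝ) (hε : 0 < ε) :
    Tendsto (fun B : ℕ => RapGclc.rapProb M p fun C : RapGclc.Placement n m B =>
        ∀ c : RapGclc.Demand n m L → RapGclc.Vertex n m B → ℕ,
          (∀ F, RapGclc.IsGreedyColoring C F (c F)) →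
            RapGclc.rate q C c ≤
              min (RapGclc.psi n L M q p) (RapGclc.mBar n L q - RapGclc.MBar n L M q p) + ε)
      atTop (𝓝 1) := by
  open RapGclc in
  have h0 : ∀ f, 0 ≤ p f * M := fun f => mul_nonneg (hp0 f) hM.le
  have h1 : ∀ f, p f * M ≤ 1 := fun f => (le_div_iff₀ hM).1 (hpM f)
  have hk : ∀ B f, cachedCount M p B f ≤ B := by
    intro B f
    refine Nat.floor_le_of_le ?_
    exact mul_le_of_le_one_left (Nat.cast_nonneg B) (h1 f)
  -- One `δ` pays for the random fluctuation, the other for rounding the cache sizes; `L + 1` keeps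
  -- the denominator nonzero when `L = 0`.
  obtain ⟨δ, hδ, hδε⟩ : ∃ δ : ℝ, 0 < δ ∧ 2 ^ n * (L * (δ + δ)) ≤ ε := by
    refine ⟨ε / (2 * 2 ^ n * (L + 1)), by positivity, ?_⟩
    have : (2 : ℝ) ^ n * (L * (ε / (2 * 2 ^ n * (L + 1)) + ε / (2 * 2 ^ n * (L + 1)))) =
        ε * (L / (L + 1)) := by
      field_simp
      ring
    rw [this]
    exact mul_le_of_le_one_right hε.le (div_le_one_of_le₀ (by linarith) (by positivity))
  have hlow : Tendsto (fun B : ℕ =>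
      1 - Fintype.card (Fin m × Finset (Fin n)) * (1 / (δ ^ 2 * (B : ℝ)))) atTop (𝓝 1) := by
    have h : Tendsto (fun B : ℕ => 1 / (δ ^ 2 * (B : ℝ))) atTop (𝓝 0) := by
      refine Tendsto.div_atTop tendsto_const_nhds ?_
      exact tendsto_natCast_atTop_atTop.const_mul_atTop (by positivity)
    simpa using (h.const_mul (Fintype.card (Fin m × Finset (Fin n)) : ℝ)).const_sub 1
  have hmB : ∀ᶠ B : ℕ in atTop, (m : ℝ) / B ≤ ε :=
    (tendsto_const_div_atTop_nhds_zero_nat (m : ℝ)).eventually_le_const hε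
  refine tendsto_of_tendsto_of_tendsto_of_le_of_le' hlow tendsto_const_nhds ?_
    (Eventually.of_forall fun B => rapProb_le_one (hk B) _)
  filter_upwards [hmB, eventually_gt_atTop 0, eventually_exactProb_le (n := n) h0 hδ]
    with B hmB hB hexact
  let bad : Fin m × Finset (Fin n) → Placement n m B → Prop := fun i C =>
    B * (exactProb (cachedCount M p B i.1 / B : ℝ) i.2 + δ) < exactCount C i.1 i.2
  refine le_trans ?_ (one_sub_le_rapProb_forall (hk B) _ bad fun C hC hgood c hc => ?_)
  · refine sub_le_sub_left ?_ 1
    rw [← nsmul_eq_mul, ← Finset.card_univ]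
    exact Finset.sum_le_card_nsmul _ _ _
      fun i _ => rapProb_exactCount_gt_le hB (hk B) i.1 i.2 hδ
  · rw [← min_add_add_right]
    refine le_min ?_ ?_
    · refine (rate_le_psi hq0 hq1 h0 h1 hB (add_nonneg hδ.le hδ.le) (fun f T => ?_) hc).trans
        (by linarith)
      refine (not_lt.1 (hgood (f, T))).trans ?_
      have := hexact f T
      refine mul_le_mul_of_nonneg_left ?_ (Nat.cast_nonneg B)
      dsimp only
      linarith
    · exact (rate_le_mBar_sub hq0 hq1 hB (hk B) (card_eq_of_placementProb_ne_zero hC) c).trans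
        (by linarith)
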